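/- Write \(L^2\) for the real Hilbert space \(L^2([0,1])\). Let \(\sigma:\mathbb R\to\mathbb R\) be continuous and not a polynomial function, and fix a degree \(d\in\mathbb N=\{0,1,2,\dots\}\). A B-spline basis \(\mathbf B_L=\{B_1,\dots,B_L\}\) of degree \(d\) on \([0,1]\) is given by knots \(t_0\le t_1\le\dots\le t_{L+d}\) with \(t_d=0<t_{d+1}\), \(t_{L-1}<1=t_L\) and \(t_i<t_{i+d+1}\) for \(0\le i<L\). It consists of the \(L\) B-splines of degree \(d\) with these knots (given by the Cox–de Boor recursion), restricted to \([0,1]\). Its mesh is \(\max_{d\le i<L}(t_{i+1}-t_i)\). For \(X\in L^2\), the coordinates \(x_1,\dots,x_L\) of \(X\) on \(\mathbf B_L\) are the coefficients in \(\sum_{h=1}^L x_hB_h\) of the orthogonal projection of \(X\) onto \(\operatorname{span}\mathbf B_L\); equivalently, \(\sum_{h=1}^L x_h\int_0^1B_hB_l=\int_0^1XB_l\) for all \(l\). Let \(\mathcal S(\sigma,\mathbf B_L)\) be the set of functions \(L^2\to\mathbb R\) of the form \[X\mapsto\sum_{j=1}^{J}w_j\,\sigma\Big(b_j+\sum_{h=1}^{L}d_{jh}x_h\Big),\qquad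 J\in\mathbb N,\ J\ge1,\ w_j,b_j,d_{jh}\in\mathbb R.\] Theorem. These classes have the universal approximation property as the basis is refined: for every compact \(K\subset L^2\), every continuous \(F:K\to\mathbb R\) and every \(\varepsilon>0\) there is \(\delta>0\) such that for every \(L\) and every B-spline basis \(\mathbf B_L\) of degree \(d\) with mesh less than \(\delta\), there exists \(G\in\mathcal S(\sigma,\mathbf B_L)\) with \(|G(X)-F(X)|<\varepsilon\) for all \(X\in K\). (In particular, for equally spaced knots this holds for all sufficiently large \(L\).) -/

import Mathlib

open MeasureTheory

noncomputable section

namespace FunNet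

/-- Lebesgue measure on the interval `[0, 1]`. -/
abbrev unitMeasure : Measure ℝ := volume.restrict (Set.Icc (0 : ℝ) 1)

/-- The real Hilbert space `L²([0, 1])`. -/
abbrev L2 : Type := Lp ℝ 2 unitMeasure

/-- The `i`-th B-spline of degree `k` for the knots `t 0 ≤ t 1 ≤ ⋯`, by the Cox-de Boor recursion.
The usual convention that a term with zero denominator is zero is Lean's convention on division. -/
def bspline (t : ℕ → ℝ) : ℕ → ℕ → ℝ → ℝ
  | 0, i, x => Set.indicator (Set.Ico (t i) (t (i + 1))) (fun _ => (1 : ℝ)) x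
  | k + 1, i, x =>
      (x - t i) / (t (i + k + 1) - t i) * bspline t k i x
        + (t (i + k + 2) - x) / (t (i + k + 2) - t (i + 1)) * bspline t k (i + 1) x

/-- Knots `t 0 ≤ ⋯ ≤ t (L + d)` of a basis of `L` B-splines of degree `d` on `[0, 1] = [t d, t L]`.
No B-spline of the basis vanishes identically on `[0, 1]`, the knots up to `t d` and from `t L` on
need not coincide, and multiple interior knots are allowed.
(The values of `t` beyond the index `L + d` play no role.) -/
structure Knots (d L : ℕ) where
  t : ℕ → ℝ
  mono : Monotone t
  left : t d = 0
  right : t L = 1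
  left_lt : t d < t (d + 1)
  lt_right : t (L - 1) < t L
  support : ∀ i < L, t i < t (i + d + 1)

/-- Consecutive knots in `[0, 1]` are less than `δ` apart. -/
def Knots.MeshLT {d L : ℕ} (τ : Knots d L) (δ : ℝ) : Prop :=
  ∀ i, d ≤ i → i < L → τ.t (i + 1) - τ.t i < δ

theorem measurable_bspline (t : ℕ → ℝ) (k : ℕ) : ∀ i, Measurable (bspline t k i) := by
  induction k with
  | zero => intro i; exact measurable_const.indicator measurableSet_Ico
  | succ k ih =>
    intro i
    have h1 := ih i
    have h2 := ih (i + 1)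
    change Measurable (fun x => (x - t i) / (t (i + k + 1) - t i) * bspline t k i x
        + (t (i + k + 2) - x) / (t (i + k + 2) - t (i + 1)) * bspline t k (i + 1) x)
    fun_prop

theorem bspline_bounded (t : ℕ → ℝ) (k : ℕ) :
    ∀ i, ∃ C : ℝ, ∀ x ∈ Set.Icc (0 : ℝ) 1, |bspline t k i x| ≤ C := by
  induction k with
  | zero =>
    intro i
    refine ⟨1, fun x _ => ?_⟩
    unfold bspline Set.indicator
    split_ifs <;> simp
  | succ k ih =>
    intro i
    obtain ⟨C, hC⟩ := ih i
    obtain ⟨D, hD⟩ := ih (i + 1)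
    have bd : ∀ f : ℝ → ℝ, Continuous f → ∃ M, ∀ x ∈ Set.Icc (0 : ℝ) 1, |f x| ≤ M := by
      intro f hf
      obtain ⟨M, hM⟩ := isCompact_Icc.exists_bound_of_continuousOn (s := Set.Icc (0 : ℝ) 1)
        hf.continuousOn
      exact ⟨M, fun x hx => by simpa using hM x hx⟩
    obtain ⟨M, hM⟩ := bd (fun x => (x - t i) / (t (i + k + 1) - t i)) (by fun_prop)
    obtain ⟨N, hN⟩ := bd (fun x => (t (i + k + 2) - x) / (t (i + k + 2) - t (i + 1)))
      (by fun_prop)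
    refine ⟨M * C + N * D, fun x hx => ?_⟩
    unfold bspline
    refine (abs_add_le _ _).trans (add_le_add ?_ ?_)
    · rw [abs_mul]
      exact mul_le_mul (hM x hx) (hC x hx) (abs_nonneg _) ((abs_nonneg _).trans (hM x hx))
    · rw [abs_mul]
      exact mul_le_mul (hN x hx) (hD x hx) (abs_nonneg _) ((abs_nonneg _).trans (hN x hx))

theorem memLp_bspline (t : ℕ → ℝ) (k i : ℕ) : MemLp (bspline t k i) 2 unitMeasure := by
  obtain ⟨C, hC⟩ := bspline_bounded t k i
  refine MemLp.of_bound (measurable_bspline t k i).aestronglyMeasurable C ?_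
  filter_upwards [ae_restrict_mem measurableSet_Icc] with x hx
  simpa using hC x hx

/-- The B-spline basis `B_0, …, B_{L-1}` of degree `d` with the given knots, in `L²([0, 1])`. -/
def Knots.basis {d L : ℕ} (τ : Knots d L) (i : Fin L) : L2 :=
  (memLp_bspline τ.t d i).toLp (bspline τ.t d i)

/-- The spline space: the linear span of the B-spline basis. -/
def Knots.space {d L : ℕ} (τ : Knots d L) : Submodule ℝ L2 :=
  Submodule.span ℝ (Set.range τ.basis)

instance {d L : ℕ} (τ : Knots d L) : FiniteDimensional ℝ τ.space :=
  FiniteDimensional.span_of_finite ℝ (Set.finite_range τ.basis)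

theorem Knots.exists_coord {d L : ℕ} (τ : Knots d L) (X : L2) :
    ∃ x : Fin L → ℝ, ∑ h, x h • τ.basis h = τ.space.starProjection X :=
  (Submodule.mem_span_range_iff_exists_fun ℝ).1 (τ.space.starProjection_apply_mem X)

/-- The coordinates `x_h` of `X` on the B-spline basis: the coefficients of the orthogonal
projection of `X` onto the spline space (they are unique, as B-splines are linearly independent).
Equivalently, `∑ h, x_h ∫ B_h B_l = ∫ X B_l` for all `l`. -/
def Knots.coord {d L : ℕ} (τ : Knots d L) (X : L2) : Fin L → ℝ :=
  Classical.choose (τ.exists_coord X)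

/-- The one-hidden-layer networks
`X ↦ ∑ j, w j * σ (b j + ∑ h, D j h * x h)`, where `x h` are the coordinates of `X` on the B-spline
basis and the number `J` of neurons is positive. -/
def networks (σ : ℝ → ℝ) {d L : ℕ} (τ : Knots d L) : Set (L2 → ℝ) :=
  {G | ∃ (J : ℕ) (_ : 0 < J) (w b : Fin J → ℝ) (D : Fin J → Fin L → ℝ),
    ∀ X, G X = ∑ j, w j * σ (b j + ∑ h, D j h * τ.coord X h)}

end FunNet

end

/-!
The argument has two independent halves, joined by a perturbation estimate.

*Universal approximation on a compact subset of a Hilbert space.* Let `V` be a linear space of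
continuous functions separating the points of a compact space `K`. The functions `σ (u + b)`,
`u ∈ V`, `b ∈ ℝ`, span a dense subspace of `C(K, ℝ)` (`topologicalClosure_span_ridge`). To see
this, let `Λ` be the quotient map of `C(K, ℝ)` by the closure of this span; it kills every ridge
function `σ (s u + b)`. Hence it kills the ridge functions of each mollification `g` of `σ`, and,
by differentiating `n` times in `s`, the functions `uⁿ g⁽ⁿ⁾(s u + b)`; at `s = 0` this reads
`g⁽ⁿ⁾(b) Λ(uⁿ) = 0`. If `Λ(uⁿ) ≠ 0` for some `n`, then every mollification of `σ` is a polynomial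
of degree less than `n`, and so is their pointwise limit `σ`, which is excluded
(`annihilates_pow`). So `Λ` kills all powers of `u`, hence `exp u`, and the functions `exp u` span
a subalgebra to which the Stone-Weierstrass theorem applies. For `K` in a Hilbert space, `V`
consists of the functions `X ↦ ⟪Y, X⟫`.

*Density of splines.* B-splines are nonnegative, form a partition of unity on `[0, 1)`, and have
supports of length `O(mesh)`. Therefore the quasi-interpolant `∑ f(ξ_i) B_i`, with `ξ_i` in the
support of `B_i`, is uniformly close to a continuous `f`, and the orthogonal projections of a fixed
`Y` onto the spline spaces converge to `Y` (`eventually_norm_sub_starProjection_lt`).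

*Conclusion.* Fix a network in the inner products `⟪Y_j, X⟫` that approximates `F` on `K`. Replacing
`Y_j` by its projection `P Y_j` changes it little when the mesh is small. The result is a network in
the spline coordinates, because `⟪P Y_j, X⟫ = ⟪Y_j, P X⟫ = ∑ h, ⟪Y_j, B_h⟫ x_h`. Only the defining
property of the coordinates is used here, so linear independence of the B-splines is not needed.
-/

open Filter Topology
open scoped BoundedContinuousFunction Convolution ContDiff

namespace FunNet

/-! ### B-splines: support, positivity and partition of unity -/

/-- The B-spline of degree `k` is supported in `[t i, t (i + k + 1))`. -/
theorem bspline_eq_zero {t : ℕ → ℝ} (ht : Monotone t) (k : ℕ) :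
    ∀ {i : ℕ} {x : ℝ}, x ∉ Set.Ico (t i) (t (i + k + 1)) → bspline t k i x = 0 := by
  induction k with
  | zero => intro i x hx; simpa [bspline] using hx
  | succ k ih =>
    intro i x hx
    have h1 := ht (show i ≤ i + 1 by omega)
    have h2 := ht (show i + k + 1 ≤ i + (k + 1) + 1 by omega)
    have h3 : i + 1 + k + 1 = i + (k + 1) + 1 := by omega
    rw [bspline, ih fun h => hx ⟨h.1, h.2.trans_le h2⟩,
      ih (i := i + 1) fun h => hx ⟨h1.trans h.1, h3 ▸ h.2⟩]
    simp

theorem bspline_nonneg {t : ℕ → ℝ} (ht : Monotone t) (k : ℕ) :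
    ∀ (i : ℕ) (x : ℝ), 0 ≤ bspline t k i x := by
  induction k with
  | zero => intro i x; exact Set.indicator_nonneg (fun _ _ => zero_le_one) x
  | succ k ih =>
    intro i x
    rw [bspline]
    refine add_nonneg ?_ ?_
    · by_cases hx : x ∈ Set.Ico (t i) (t (i + k + 1))
      · exact mul_nonneg (div_nonneg (sub_nonneg.2 hx.1) (sub_nonneg.2 (ht (by omega)))) (ih _ _)
      · simp [bspline_eq_zero ht k hx]
    · by_cases hx : x ∈ Set.Ico (t (i + 1)) (t (i + 1 + k + 1))
      · refine mul_nonneg (div_nonneg (sub_nonneg.2 ?_) (sub_nonneg.2 (ht (by omega)))) (ih _ _)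
        exact hx.2.le.trans (ht (by omega))
      · simp [bspline_eq_zero ht k hx]

theorem sum_bspline_zero {t : ℕ → ℝ} (ht : Monotone t) {m n : ℕ} (hmn : m ≤ n) (x : ℝ) :
    ∑ i ∈ Finset.Ico m n, bspline t 0 i x
      = Set.indicator (Set.Ico (t m) (t n)) (fun _ => (1 : ℝ)) x := by
  induction n, hmn using Nat.le_induction with
  | base => simp
  | succ n hmn ih =>
    rw [Finset.sum_Ico_succ_top hmn, ih, bspline,
      ← Set.Ico_union_Ico_eq_Ico (ht hmn) (ht n.le_succ),
      Set.indicator_union_of_disjoint (Set.Ico_disjoint_Ico_same)]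

/-- Partition of unity: the B-splines of degree `k` and index in `[m, n)` add up to `1` between the
knots `t (m + k)` and `t n`. In the recursion, the two end terms vanish there. -/
theorem sum_bspline {t : ℕ → ℝ} (ht : Monotone t) (n k : ℕ) :
    ∀ {m : ℕ} {x : ℝ}, t (m + k) ≤ x → x < t n → ∑ i ∈ Finset.Ico m n, bspline t k i x = 1 := by
  induction k with
  | zero =>
    intro m x hmx hxn
    have hmn : m ≤ n := by
      by_contra h
      exact absurd (hmx.trans_lt hxn) (not_lt.2 (ht (by omega)))
    rw [sum_bspline_zero ht hmn]
    exact Set.indicator_of_mem (s := Set.Ico (t m) (t n)) ⟨hmx, hxn⟩ _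
  | succ k ih =>
    intro m x hmx hxn
    have hmn : m + 1 ≤ n := by
      by_contra h
      exact absurd (hmx.trans_lt hxn) (not_lt.2 (ht (by omega)))
    -- the two weights which `B_{i,k}` receives in the recursion add up to `1`
    have hw : ∀ i, (x - t i) / (t (i + k + 1) - t i) * bspline t k i x
        + (t (i + k + 1) - x) / (t (i + k + 1) - t i) * bspline t k i x = bspline t k i x := by
      intro i
      by_cases hx : x ∈ Set.Ico (t i) (t (i + k + 1))
      · have : t (i + k + 1) - t i ≠ 0 := (sub_pos.2 (hx.1.trans_lt hx.2)).ne'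
        field_simp
        ring
      · simp [bspline_eq_zero ht k hx]
    have hfirst : bspline t k m x = 0 :=
      bspline_eq_zero ht k fun h => absurd h.2 (not_lt.2 (by rwa [add_assoc]))
    have hlast : bspline t k n x = 0 := bspline_eq_zero ht k fun h => absurd hxn (not_lt.2 h.1)
    have hih : ∑ i ∈ Finset.Ico (m + 1) n, bspline t k i x = 1 :=
      ih (by rwa [add_right_comm]) hxn
    simp only [bspline, Finset.sum_add_distrib]
    rw [Finset.sum_eq_sum_Ico_succ_bot (by omega : m < n), hfirst, mul_zero, zero_add]
    have hshift : ∑ i ∈ Finset.Ico m n,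
          (t (i + k + 2) - x) / (t (i + k + 2) - t (i + 1)) * bspline t k (i + 1) x
        = ∑ i ∈ Finset.Ico (m + 1) n,
          (t (i + k + 1) - x) / (t (i + k + 1) - t i) * bspline t k i x := by
      have := Finset.sum_Ico_add' (fun i => (t (i + k + 1) - x) / (t (i + k + 1) - t i)
        * bspline t k i x) m n 1
      rw [Finset.sum_Ico_succ_top hmn, hlast, mul_zero, add_zero] at this
      rw [← this]
      refine Finset.sum_congr rfl fun i _ => ?_
      rw [show i + 1 + k + 1 = i + k + 2 by omega]
    rw [hshift, ← Finset.sum_add_distrib]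
    simp only [hw, hih]

/-! ### Approximation by splines in `L²` -/

theorem Knots.sub_le_of_meshLT {d L : ℕ} {τ : Knots d L} {δ : ℝ} (h : τ.MeshLT δ) {m : ℕ}
    (hm : d ≤ m) (k : ℕ) (hk : m + k ≤ L) : τ.t (m + k) - τ.t m ≤ k * δ := by
  induction k with
  | zero => simp
  | succ k ih =>
    have h1 := ih (by omega)
    have h2 := h (m + k) (by omega) (by omega)
    rw [← add_assoc]
    push_cast
    linarith

/-- The knot `t (max i d)`, that is, `t i` moved into `[0, 1]`, is close to each point of `[0, 1)`
at which the `i`-th B-spline does not vanish. (Knots outside `[0, 1]` may be far away.) -/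
theorem Knots.mem_Icc_of_bspline_ne_zero {d L : ℕ} {τ : Knots d L} {δ : ℝ} (h : τ.MeshLT δ)
    (hδ : 0 < δ) {i : ℕ} {x : ℝ} (hx : x ∈ Set.Ico (0 : ℝ) 1) (hi : bspline τ.t d i x ≠ 0) :
    τ.t (max i d) ∈ Set.Icc (0 : ℝ) 1 ∧ dist x (τ.t (max i d)) < (d + 2) * δ := by
  have hxi : x ∈ Set.Ico (τ.t i) (τ.t (i + d + 1)) :=
    not_not.1 fun hn => hi (bspline_eq_zero τ.mono d hn)
  have h0 : 0 ≤ τ.t (max i d) := τ.left ▸ τ.mono (le_max_right i d)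
  have h1 : τ.t (max i d) ≤ x := by
    rcases le_total i d with hid | hid
    · rw [max_eq_right hid, τ.left]; exact hx.1
    · rw [max_eq_left hid]; exact hxi.1
  refine ⟨⟨h0, h1.trans hx.2.le⟩, ?_⟩
  have hL : max i d < L := by
    by_contra hn
    have := τ.mono (not_lt.1 hn)
    rw [τ.right] at this
    linarith [hx.2]
  -- the right end of the support, cut off at `1`
  obtain ⟨k, hkd, hkL, hxk⟩ : ∃ k ≤ d + 1, max i d + k ≤ L ∧ x ≤ τ.t (max i d + k) := by
    rcases le_total (max i d + (d + 1)) L with hle | hle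
    · exact ⟨d + 1, le_rfl, hle, hxi.2.le.trans (τ.mono (by have := le_max_left i d; omega))⟩
    · refine ⟨L - max i d, by omega, by omega, ?_⟩
      rw [Nat.add_sub_cancel' hL.le, τ.right]
      exact hx.2.le
  have h2 := τ.sub_le_of_meshLT h (le_max_right i d) k hkL
  have h3 : (k : ℝ) ≤ d + 1 := by exact_mod_cast hkd
  rw [Real.dist_eq, abs_of_nonneg (sub_nonneg.2 h1)]
  nlinarith

/-- The spline `∑ i, f (ξ i) B_i`, where the node `ξ i = t (max i d)` is the `i`-th knot or, if that
is negative, the point `0`. -/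
noncomputable def Knots.quasiInterpolant {d L : ℕ} (τ : Knots d L) (f : ℝ → ℝ) (x : ℝ) : ℝ :=
  ∑ i ∈ Finset.range L, f (τ.t (max i d)) * bspline τ.t d i x

/-- The quasi-interpolant is a convex combination of values of `f` at nearby points. -/
theorem Knots.dist_quasiInterpolant_le {d L : ℕ} {τ : Knots d L} {δ η : ℝ} (h : τ.MeshLT δ)
    (hδ : 0 < δ) {f : ℝ → ℝ}
    (hf : ∀ x ∈ Set.Icc (0 : ℝ) 1, ∀ y ∈ Set.Icc (0 : ℝ) 1, dist x y < (d + 2) * δ →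
      dist (f x) (f y) ≤ η) {x : ℝ} (hx : x ∈ Set.Ico (0 : ℝ) 1) :
    |f x - τ.quasiInterpolant f x| ≤ η := by
  have hsum : ∑ i ∈ Finset.range L, bspline τ.t d i x = 1 := by
    rw [Finset.range_eq_Ico]
    exact sum_bspline τ.mono L d (by rw [zero_add, τ.left]; exact hx.1) (τ.right ▸ hx.2)
  have h1 : f x - τ.quasiInterpolant f x
      = ∑ i ∈ Finset.range L, (f x - f (τ.t (max i d))) * bspline τ.t d i x := by
    simp only [sub_mul, Finset.sum_sub_distrib, ← Finset.mul_sum, hsum, mul_one]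
    rfl
  calc |f x - τ.quasiInterpolant f x|
      ≤ ∑ i ∈ Finset.range L, |(f x - f (τ.t (max i d))) * bspline τ.t d i x| :=
        h1 ▸ Finset.abs_sum_le_sum_abs _ _
    _ ≤ ∑ i ∈ Finset.range L, η * bspline τ.t d i x := by
        refine Finset.sum_le_sum fun i _ => ?_
        by_cases hi : bspline τ.t d i x = 0
        · simp [hi]
        obtain ⟨hm, hd⟩ := Knots.mem_Icc_of_bspline_ne_zero h hδ hx hi
        rw [abs_mul, abs_of_nonneg (bspline_nonneg τ.mono d i x)]
        exact mul_le_mul_of_nonneg_right (hf x ⟨hx.1, hx.2.le⟩ _ hm hd)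
          (bspline_nonneg τ.mono d i x)
    _ = η := by rw [← Finset.mul_sum, hsum, mul_one]

theorem Knots.exists_mem_space_coeFn_eq {d L : ℕ} (τ : Knots d L) (f : ℝ → ℝ) :
    ∃ s ∈ τ.space, s =ᵐ[unitMeasure] τ.quasiInterpolant f := by
  refine ⟨∑ i : Fin L, f (τ.t (max i d)) • τ.basis i, Submodule.sum_mem _ fun i _ =>
    Submodule.smul_mem _ _ (Submodule.subset_span (Set.mem_range_self i)), ?_⟩
  have h1 : ∀ᵐ x ∂unitMeasure, ∀ i : Fin L,
      (f (τ.t (max i d)) • τ.basis i : L2) x = f (τ.t (max i d)) * bspline τ.t d i x := by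
    refine ae_all_iff.2 fun i => ?_
    filter_upwards [Lp.coeFn_smul (f (τ.t (max i d))) (τ.basis i),
      (memLp_bspline τ.t d i).coeFn_toLp] with x hx hx'
    rw [hx, Pi.smul_apply, smul_eq_mul, ← hx']
    rfl
  filter_upwards [h1, Lp.coeFn_finsetSum Finset.univ
    fun i : Fin L => (f (τ.t (max i d)) • τ.basis i : L2)] with x hx hx'
  rw [hx', Knots.quasiInterpolant, Finset.sum_range, Finset.sum_apply]
  exact Finset.sum_congr rfl fun i _ => hx i

theorem eventually_exists_mem_space_norm_le (d : ℕ) (f : ℝ →ᵇ ℝ) {η : ℝ} (hη : 0 < η) :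
    ∀ᶠ δ in 𝓝[>] (0 : ℝ), ∀ (L : ℕ) (τ : Knots d L), τ.MeshLT δ →
      ∃ s ∈ τ.space, ‖BoundedContinuousFunction.toLp 2 unitMeasure ℝ f - s‖ ≤ η := by
  obtain ⟨ρ, hρ, hf⟩ := Metric.uniformContinuousOn_iff.1
    (isCompact_Icc.uniformContinuousOn_of_continuous (s := Set.Icc (0 : ℝ) 1)
      f.continuous.continuousOn) η hη
  have hd : (0 : ℝ) < d + 2 := by positivity
  filter_upwards [Ioc_mem_nhdsGT (div_pos hρ hd)] with δ hδ L τ h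
  obtain ⟨s, hs, hsf⟩ := τ.exists_mem_space_coeFn_eq f
  refine ⟨s, hs, ?_⟩
  have hle : ∀ᵐ x ∂unitMeasure,
      ‖(BoundedContinuousFunction.toLp 2 unitMeasure ℝ f - s) x‖ ≤ η := by
    -- the B-splines need not add up to `1` at the right end point
    have hne : ∀ᵐ x ∂unitMeasure, x ≠ 1 := Measure.ae_ne _ _
    filter_upwards [hsf, Lp.coeFn_sub (BoundedContinuousFunction.toLp 2 unitMeasure ℝ f) s,
      BoundedContinuousFunction.coeFn_toLp 2 unitMeasure ℝ f, hne,
      ae_restrict_mem measurableSet_Icc] with x h1 h2 h3 h4 h5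
    rw [h2, Pi.sub_apply, h1, h3, Real.norm_eq_abs]
    refine Knots.dist_quasiInterpolant_le h hδ.1 (fun y hy z hz hyz => (hf y hy z hz ?_).le)
      ⟨h5.1, lt_of_le_of_ne h5.2 h4⟩
    exact hyz.trans_le ((le_div_iff₀' hd).1 hδ.2)
  have hu : measureUnivNNReal unitMeasure = 1 := by ext; simp [measureUnivNNReal]
  simpa [hu] using Lp.norm_le_of_ae_bound hη.le hle

/-- Orthogonal projections onto the spline spaces converge strongly to the identity, uniformly over
all bases of small mesh. -/
theorem eventually_norm_sub_starProjection_lt (d : ℕ) (Y : L2) {η : ℝ} (hη : 0 < η) :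
    ∀ᶠ δ in 𝓝[>] (0 : ℝ), ∀ (L : ℕ) (τ : Knots d L), τ.MeshLT δ →
      ‖Y - τ.space.starProjection Y‖ < η := by
  obtain ⟨f, hf⟩ := (BoundedContinuousFunction.toLp_denseRange ℝ unitMeasure ℝ
    (p := 2) (by simp)).exists_dist_lt Y (half_pos hη)
  filter_upwards [eventually_exists_mem_space_norm_le d f (half_pos (half_pos hη))] with δ h L τ hτ
  obtain ⟨s, hs, hfs⟩ := h L τ hτ
  have hmin : ‖Y - τ.space.starProjection Y‖ ≤ ‖Y - s‖ := by
    rw [Submodule.starProjection_minimal]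
    exact ciInf_le (f := fun x : τ.space => ‖Y - x‖)
      ⟨0, by rintro _ ⟨x, rfl⟩; exact norm_nonneg _⟩ ⟨s, hs⟩
  have htri := norm_sub_le_norm_sub_add_norm_sub Y
    (BoundedContinuousFunction.toLp 2 unitMeasure ℝ f) s
  rw [dist_eq_norm] at hf
  linarith

/-! ### Limits of polynomials of bounded degree -/

theorem exists_coeff_of_iteratedDeriv_eq_zero (n : ℕ) :
    ∀ {g : ℝ → ℝ}, ContDiff ℝ ∞ g → (∀ x, iteratedDeriv n g x = 0) →
      ∃ c : ℕ → ℝ, ∀ x, g x = ∑ k ∈ Finset.range n, c k * x ^ k := by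
  induction n with
  | zero =>
    intro g _ h
    exact ⟨0, fun x => by simpa using h x⟩
  | succ n ih =>
    intro g hg h
    obtain ⟨c, hc⟩ := ih (contDiff_infty_iff_deriv.1 hg).2
      fun x => by rw [← iteratedDeriv_succ']; exact h x
    -- `g` differs by a constant from the termwise antiderivative of `deriv g`
    have hd : ∀ x, HasDerivAt
        (fun x => g x - ∑ k ∈ Finset.range n, c k / (k + 1) * x ^ (k + 1)) 0 x := by
      intro x
      have h1 : HasDerivAt (fun x => ∑ k ∈ Finset.range n, c k / (k + 1) * x ^ (k + 1))
          (∑ k ∈ Finset.range n, c k * x ^ k) x := by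
        refine HasDerivAt.fun_sum fun k _ => ?_
        refine ((hasDerivAt_pow (k + 1) x).const_mul (c k / (k + 1))).congr_deriv ?_
        rw [Nat.add_sub_cancel]
        push_cast
        field_simp
      have h2 : HasDerivAt g (deriv g x) x :=
        ((contDiff_infty_iff_deriv.1 hg).1 x).hasDerivAt
      exact (h2.sub h1).congr_deriv (by rw [hc, sub_self])
    have hconst := is_const_of_deriv_eq_zero (fun x => (hd x).differentiableAt)
      fun x => (hd x).deriv
    refine ⟨fun k => k.casesOn (g 0) fun k => c k / (k + 1), fun x => ?_⟩
    have := hconst x 0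
    rw [Finset.sum_range_succ']
    simp at this ⊢
    linarith

theorem exists_polynomial_of_iteratedDeriv_eq_zero {n : ℕ} {g : ℝ → ℝ} (hg : ContDiff ℝ ∞ g)
    (h : ∀ x, iteratedDeriv n g x = 0) :
    ∃ p : Polynomial ℝ, p.degree < n ∧ ∀ x, g x = p.eval x := by
  obtain ⟨c, hc⟩ := exists_coeff_of_iteratedDeriv_eq_zero n hg h
  refine ⟨_, Polynomial.degree_sum_fin_lt fun k : Fin n => c k, fun x => ?_⟩
  simp [hc, Finset.sum_range, Polynomial.eval_finsetSum]

/-- A pointwise limit of polynomials of degree less than `n` is a polynomial: each of them is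
recovered by Lagrange interpolation from its values at `0, …, n - 1`, and these values converge. -/
theorem exists_polynomial_of_tendsto {n : ℕ} {σ : ℝ → ℝ} {g : ℕ → ℝ → ℝ}
    (hg : ∀ j, ∃ p : Polynomial ℝ, p.degree < n ∧ ∀ x, g j x = p.eval x)
    (hlim : ∀ x, Tendsto (fun j => g j x) atTop (𝓝 (σ x))) :
    ∃ p : Polynomial ℝ, ∀ x, σ x = p.eval x := by
  choose p hp hgp using hg
  have hinj : Set.InjOn (fun i : ℕ => (i : ℝ)) (Finset.range n : Finset ℕ) :=
    fun a _ b _ h => Nat.cast_injective (R := ℝ) h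
  refine ⟨Lagrange.interpolate (Finset.range n) (fun i : ℕ => (i : ℝ)) (fun i => σ i),
    fun x => ?_⟩
  refine tendsto_nhds_unique (hlim x) ?_
  have h1 : ∀ j, g j x = ∑ i ∈ Finset.range n,
      g j i * (Lagrange.basis (Finset.range n) (fun i : ℕ => (i : ℝ)) i).eval x := by
    intro j
    rw [hgp]
    conv_lhs => rw [Lagrange.eq_interpolate hinj (f := p j) (by simpa using hp j)]
    simp [Lagrange.interpolate_apply, Polynomial.eval_finsetSum, hgp]
  simp only [h1, Lagrange.interpolate_apply, Polynomial.eval_finsetSum, Polynomial.eval_mul,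
    Polynomial.eval_C]
  exact tendsto_finsetSum _ fun i _ => (hlim i).mul_const _

/-! ### Operators annihilating ridge functions -/

/-- The ridge function `x ↦ f (s * u x + b)`, with scale `s` and offset `b`. -/
def ridge {K : Type*} [TopologicalSpace K] {f : ℝ → ℝ} (hf : Continuous f) (u : C(K, ℝ))
    (s b : ℝ) : C(K, ℝ) :=
  ⟨fun x => f (s * u x + b), by fun_prop⟩

section Annihilator

variable {K Q : Type*} [TopologicalSpace K] [CompactSpace K]
  [NormedAddCommGroup Q] [NormedSpace ℝ Q]

/-- The ridge functions of `φ ⋆ σ` are averages of those of `σ`, by a Bochner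
integral in `C(K, ℝ)`. -/
theorem annihilates_convolution [CompleteSpace Q] {σ φ : ℝ → ℝ} (hσ : Continuous σ)
    (hφ : Continuous φ) (hφc : HasCompactSupport φ) (Λ : C(K, ℝ) →L[ℝ] Q) (u : C(K, ℝ))
    (h : ∀ s b, Λ (ridge hσ u s b) = 0)
    (hg : Continuous (φ ⋆[ContinuousLinearMap.lsmul ℝ ℝ, volume] σ)) (s b : ℝ) :
    Λ (ridge hg u s b) = 0 := by
  -- the translates of the ridge function, as a continuous curve in `C(K, ℝ)`
  let Γ : C(ℝ, C(K, ℝ)) := ContinuousMap.curry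
    ⟨fun q : ℝ × K => σ (s * u q.2 + b - q.1), by fun_prop⟩
  have hΓ : ∀ y, Γ y = ridge hσ u s (b - y) := fun y => by
    ext x; simp [Γ, ridge, add_sub_assoc]
  have hint : Integrable (fun y => φ y • Γ y) volume :=
    (hφ.smul Γ.continuous).integrable_of_hasCompactSupport (hφc.smul_right)
  have key : ridge hg u s b = ∫ y, φ y • Γ y := by
    ext x
    rw [ContinuousMap.integral_apply hint]
    simp [ridge, Γ, convolution_def]
  rw [key, ← Λ.integral_comp_comm hint]
  simp [hΓ, h]

/-- The derivative of `uⁿ g⁽ⁿ⁾(s u + b)` in the parameter `s` is `uⁿ⁺¹ g⁽ⁿ⁺¹⁾(s u + b)`. It is taken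
in `C(K, ℝ)`, where it commutes with `Λ`, through the fundamental theorem of calculus. -/
theorem annihilates_pow_mul_iteratedDeriv [CompleteSpace Q] {g : ℝ → ℝ} (hg : ContDiff ℝ ∞ g)
    (Λ : C(K, ℝ) →L[ℝ] Q) (u : C(K, ℝ)) (h : ∀ s b, Λ (ridge hg.continuous u s b) = 0) (n : ℕ) :
    ∀ s b, Λ (u ^ n * ridge (hg.continuous_iteratedDeriv n (by exact_mod_cast le_top)) u s b)
      = 0 := by
  induction n with
  | zero => simpa [ridge] using h
  | succ n ih =>
    intro s b
    have hn : Continuous (iteratedDeriv n g) :=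
      hg.continuous_iteratedDeriv n (by exact_mod_cast le_top)
    have hn' : Continuous (iteratedDeriv (n + 1) g) :=
      hg.continuous_iteratedDeriv (n + 1) (by exact_mod_cast le_top)
    let Γ : C(ℝ, C(K, ℝ)) := ContinuousMap.curry
      ⟨fun q : ℝ × K => u q.2 ^ (n + 1) * iteratedDeriv (n + 1) g (q.1 * u q.2 + b), by fun_prop⟩
    have hΓ : ∀ r, Γ r = u ^ (n + 1) * ridge hn' u r b := fun r => by
      ext x; simp [Γ, ridge]
    have hii : ∀ r, IntervalIntegrable Γ volume 0 r := fun r =>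
      Γ.continuous.intervalIntegrable _ _
    have key : ∀ r, ∫ t in (0 : ℝ)..r, Γ t = u ^ n * ridge hn u r b - u ^ n * ridge hn u 0 b := by
      intro r
      ext x
      have hd : ∀ t ∈ Set.uIcc 0 r, HasDerivAt
          (fun t => u x ^ n * iteratedDeriv n g (t * u x + b)) (Γ t x) t := by
        intro t _
        have h1 : HasDerivAt (iteratedDeriv n g) (iteratedDeriv (n + 1) g (t * u x + b))
            (t * u x + b) := by
          rw [iteratedDeriv_succ]
          exact ((hg.differentiable_iteratedDeriv n
            (by exact_mod_cast WithTop.coe_lt_top n)) _).hasDerivAt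
        have h2 : HasDerivAt (fun t : ℝ => t * u x + b) (u x) t := by
          simpa using ((hasDerivAt_id t).mul_const (u x)).add_const b
        refine ((h1.comp t h2).const_mul (u x ^ n)).congr_deriv ?_
        change _ = u x ^ (n + 1) * iteratedDeriv (n + 1) g (t * u x + b)
        ring
      have hc : Continuous fun t => Γ t x := by
        simp only [Γ, ContinuousMap.curry_apply, ContinuousMap.coe_mk]; fun_prop
      have h3 := intervalIntegral.integral_eq_sub_of_hasDerivAt hd (hc.intervalIntegrable _ _)
      have h4 := (ContinuousMap.evalCLM ℝ x).intervalIntegral_comp_comm (hii r)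
      simp only [ContinuousMap.evalCLM_apply] at h4
      rw [← h4, h3]
      simp [ridge]
    have hderiv : HasDerivAt (fun r => Λ (∫ t in (0 : ℝ)..r, Γ t)) (Λ (Γ s)) s :=
      Λ.hasFDerivAt.comp_hasDerivAt s (intervalIntegral.integral_hasDerivAt_right (hii s)
        Γ.continuous.stronglyMeasurable.stronglyMeasurableAtFilter Γ.continuous.continuousAt)
    have hzero : (fun r => Λ (∫ t in (0 : ℝ)..r, Γ t)) = fun _ => 0 := by
      funext r
      rw [key, map_sub, ih, ih, sub_zero]
    rw [hzero] at hderiv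
    rw [← hΓ]
    exact hderiv.unique (hasDerivAt_const s 0)

/-- If `Λ` killed all ridge functions of `σ` but not `u ^ n`, then all mollifications of `σ`, and so
`σ` itself, would be polynomials of degree less than `n`. -/
theorem annihilates_pow [CompleteSpace Q] {σ : ℝ → ℝ} (hσ : Continuous σ)
    (hσ' : ¬ ∃ p : Polynomial ℝ, ∀ x, σ x = p.eval x) (Λ : C(K, ℝ) →L[ℝ] Q) (u : C(K, ℝ))
    (h : ∀ s b, Λ (ridge hσ u s b) = 0) (n : ℕ) : Λ (u ^ n) = 0 := by
  by_contra hne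
  -- mollifiers with support shrinking to `0`
  let φ : ℕ → ContDiffBump (0 : ℝ) := fun j =>
    ⟨1 / (2 * (j + 1)), 1 / (j + 1), by positivity, by
      apply one_div_lt_one_div_of_lt <;> [positivity; skip]
      have : (0 : ℝ) ≤ j := j.cast_nonneg
      linarith⟩
  let g : ℕ → ℝ → ℝ := fun j =>
    (φ j).normed volume ⋆[ContinuousLinearMap.lsmul ℝ ℝ, volume] σ
  refine hσ' (exists_polynomial_of_tendsto (n := n) (g := g) (fun j => ?_) fun x => ?_)
  · have hg : ContDiff ℝ ∞ (g j) := (φ j).hasCompactSupport_normed.contDiff_convolution_left _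
      (φ j).contDiff_normed hσ.locallyIntegrable
    refine exists_polynomial_of_iteratedDeriv_eq_zero hg fun b => ?_
    -- at scale `s = 0` the factor `g⁽ⁿ⁾(s u + b)` is the constant `g⁽ⁿ⁾(b)`
    have h1 := annihilates_pow_mul_iteratedDeriv hg Λ u
      (annihilates_convolution hσ (φ j).continuous_normed (φ j).hasCompactSupport_normed Λ u h _)
      n 0 b
    have h2 : u ^ n * ridge (hg.continuous_iteratedDeriv n (by exact_mod_cast le_top)) u 0 b
        = iteratedDeriv n (g j) b • u ^ n := by
      ext x; simp [ridge, mul_comm]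
    rw [h2, map_smul] at h1
    exact (smul_eq_zero.1 h1).resolve_right hne
  · refine ContDiffBump.convolution_tendsto_right_of_continuous ?_ hσ x
    exact tendsto_one_div_add_atTop_nhds_zero_nat

theorem annihilates_exp (Λ : C(K, ℝ) →L[ℝ] Q) (u : C(K, ℝ)) (h : ∀ n : ℕ, Λ (u ^ n) = 0) :
    Λ ⟨fun x => Real.exp (u x), by fun_prop⟩ = 0 := by
  have h1 := NormedSpace.exp_series_hasSum_exp' (𝕂 := ℝ) u
  have h2 : NormedSpace.exp u = (⟨fun x => Real.exp (u x), by fun_prop⟩ : C(K, ℝ)) := by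
    ext x
    have := (ContinuousMap.evalCLM ℝ x).hasSum h1
    refine this.unique ?_
    simpa [Real.exp_eq_exp_ℝ, Function.comp_def] using
      NormedSpace.exp_series_hasSum_exp' (𝕂 := ℝ) (u x)
  have h3 := Λ.hasSum h1
  simp only [map_smul, h, smul_zero] at h3
  rw [← h2]
  exact h3.unique hasSum_zero

end Annihilator

/-! ### Density of ridge functions on a compact space -/

section Density

variable {K : Type*} [TopologicalSpace K] [CompactSpace K]

/-- The exponentials of the elements of `V` are closed under multiplication, so that their span is
the subalgebra they generate, and the Stone-Weierstrass theorem applies to it. -/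
theorem eq_top_of_exp_mem {M : Submodule ℝ C(K, ℝ)} (hM : IsClosed (M : Set C(K, ℝ)))
    (V : Submodule ℝ C(K, ℝ)) (hsep : ∀ x y : K, x ≠ y → ∃ u ∈ V, u x ≠ u y)
    (hexp : ∀ u ∈ V, (⟨fun x => Real.exp (u x), by fun_prop⟩ : C(K, ℝ)) ∈ M) : M = ⊤ := by
  let S : Submonoid C(K, ℝ) :=
    { carrier := {f | ∃ u ∈ V, f = ⟨fun x => Real.exp (u x), by fun_prop⟩}
      one_mem' := ⟨0, V.zero_mem, by ext; simp⟩
      mul_mem' := by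
        rintro _ _ ⟨u, hu, rfl⟩ ⟨v, hv, rfl⟩
        exact ⟨u + v, V.add_mem hu hv, by ext; simp [Real.exp_add]⟩ }
  have hS : Subalgebra.toSubmodule (Algebra.adjoin ℝ (S : Set C(K, ℝ))) ≤ M := by
    rw [Algebra.adjoin_eq_span, Submonoid.closure_eq, Submodule.span_le]
    rintro _ ⟨u, hu, rfl⟩
    exact hexp u hu
  have hdense := ContinuousMap.subalgebra_topologicalClosure_eq_top_of_separatesPoints
    (Algebra.adjoin ℝ (S : Set C(K, ℝ))) (by
      intro x y hxy
      obtain ⟨u, hu, huxy⟩ := hsep x y hxy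
      exact ⟨_, ⟨_, Algebra.subset_adjoin ⟨u, hu, rfl⟩, rfl⟩, by simpa using huxy⟩)
  refine eq_top_iff.2 fun f _ => closure_minimal hS hM ?_
  change f ∈ (Algebra.adjoin ℝ (S : Set C(K, ℝ))).topologicalClosure
  rw [hdense]
  trivial

/-- Universal approximation on a compact space: if `V` separates points, then the functions
`σ (u + b)` with `u ∈ V` and `b ∈ ℝ` span a dense subspace of `C(K, ℝ)`. -/
theorem topologicalClosure_span_ridge {σ : ℝ → ℝ} (hσ : Continuous σ)
    (hσ' : ¬ ∃ p : Polynomial ℝ, ∀ x, σ x = p.eval x)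
    (V : Submodule ℝ C(K, ℝ)) (hsep : ∀ x y : K, x ≠ y → ∃ u ∈ V, u x ≠ u y) :
    (Submodule.span ℝ {f | ∃ u ∈ V, ∃ b, f = ridge hσ u 1 b}).topologicalClosure = ⊤ := by
  set M := (Submodule.span ℝ {f | ∃ u ∈ V, ∃ b, f = ridge hσ u 1 b}).topologicalClosure
  have hM : IsClosed (M : Set C(K, ℝ)) := Submodule.isClosed_topologicalClosure _
  refine eq_top_of_exp_mem hM V hsep fun u hu => ?_
  let Λ : C(K, ℝ) →L[ℝ] C(K, ℝ) ⧸ M := M.mkQL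
  have hridge : ∀ s b, Λ (ridge hσ u s b) = 0 := by
    intro s b
    refine (Submodule.Quotient.mk_eq_zero M).2 (Submodule.le_topologicalClosure _
      (Submodule.subset_span ⟨s • u, V.smul_mem s hu, b, ?_⟩))
    ext x
    simp [ridge]
  have hpow : ∀ n : ℕ, Λ (u ^ n) = 0 := annihilates_pow (Q := C(K, ℝ) ⧸ M) hσ hσ' Λ u hridge
  have hzero := annihilates_exp (Q := C(K, ℝ) ⧸ M) Λ u hpow
  exact (Submodule.Quotient.mk_eq_zero M).1 hzero

end Density

/-! ### Networks on a compact subset of a Hilbert space -/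

theorem exists_network_approx {σ : ℝ → ℝ} (hσ : Continuous σ)
    (hσ' : ¬ ∃ p : Polynomial ℝ, ∀ x, σ x = p.eval x) {H : Type*} [NormedAddCommGroup H]
    [InnerProductSpace ℝ H] {K : Set H} (hK : IsCompact K) {F : K → ℝ} (hF : Continuous F)
    {ε : ℝ} (hε : 0 < ε) :
    ∃ (J : ℕ) (w b : Fin J → ℝ) (Y : Fin J → H),
      ∀ X : K, |∑ j, w j * σ (b j + inner ℝ (Y j) (X : H)) - F X| < ε := by
  have : CompactSpace K := isCompact_iff_compactSpace.1 hK
  let T : H →ₗ[ℝ] C(K, ℝ) :=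
    { toFun := fun Y => ⟨fun X => inner ℝ Y (X : H), by fun_prop⟩
      map_add' := fun Y Z => by ext; simp [inner_add_left]
      map_smul' := fun c Y => by ext; simp [inner_smul_left] }
  have hsep : ∀ x y : K, x ≠ y → ∃ u ∈ LinearMap.range T, u x ≠ u y := by
    intro x y hxy
    refine ⟨T (x - y), ⟨_, rfl⟩, fun h => hxy (Subtype.ext (sub_eq_zero.1 ?_))⟩
    rw [← inner_self_eq_zero (𝕜 := ℝ), inner_sub_right, sub_eq_zero]
    exact h
  have hmem : (⟨F, hF⟩ : C(K, ℝ)) ∈ closure (Submodule.span ℝ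
      {f | ∃ u ∈ LinearMap.range T, ∃ b, f = ridge hσ u 1 b} : Set C(K, ℝ)) := by
    rw [← Submodule.topologicalClosure_coe,
      topologicalClosure_span_ridge hσ hσ' (LinearMap.range T) hsep]
    trivial
  obtain ⟨N, hN, hNF⟩ := Metric.mem_closure_iff.1 hmem ε hε
  obtain ⟨J, w, g, rfl⟩ := Submodule.mem_span_set'.1 hN
  choose u hu b hg using fun j => (g j).2
  choose Y hY using hu
  refine ⟨J, w, b, Y, fun X => ?_⟩
  rw [dist_comm] at hNF
  convert (ContinuousMap.dist_lt_iff hε).1 hNF X using 1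
  rw [Real.dist_eq]
  simp [hg, ← hY, ridge, T, add_comm]

/-- Networks depend continuously on their inner weights `Y`, uniformly over the compact set `K`. -/
theorem exists_forall_norm_sub_lt_network {σ : ℝ → ℝ} (hσ : Continuous σ)
    {H : Type*} [NormedAddCommGroup H] [InnerProductSpace ℝ H] {K : Set H} (hK : IsCompact K)
    {J : ℕ} (w b : Fin J → ℝ) (Y : Fin J → H) {ε : ℝ} (hε : 0 < ε) :
    ∃ η > 0, ∀ Z : Fin J → H, (∀ j, ‖Y j - Z j‖ < η) → ∀ X : K,
      |∑ j, w j * σ (b j + inner ℝ (Z j) (X : H))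
        - ∑ j, w j * σ (b j + inner ℝ (Y j) (X : H))| < ε := by
  have : CompactSpace K := isCompact_iff_compactSpace.1 hK
  let Φ : C(Fin J → H, C(K, ℝ)) := ContinuousMap.curry
    ⟨fun q : (Fin J → H) × K => ∑ j, w j * σ (b j + inner ℝ (q.1 j) (q.2 : H)), by fun_prop⟩
  obtain ⟨η, hη, h⟩ := Metric.continuousAt_iff.1 (Φ.continuous.continuousAt (x := Y)) ε hε
  refine ⟨η, hη, fun Z hZ X => ?_⟩
  have hd : dist Z Y < η := (dist_pi_lt_iff hη).2 fun j => by
    rw [dist_comm, dist_eq_norm]; exact hZ j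
  exact (ContinuousMap.dist_lt_iff hε).1 (h hd) X


/-- Inner products with projections onto the spline space are linear in the coordinates. -/
theorem mem_networks_starProjection {σ : ℝ → ℝ} {d L : ℕ} (τ : Knots d L) {J : ℕ}
    (w b : Fin J → ℝ) (Y : Fin J → L2) :
    (fun X => ∑ j, w j * σ (b j + inner ℝ (τ.space.starProjection (Y j)) X)) ∈ networks σ τ := by
  -- one neuron of weight `0` is added, as the number of neurons has to be positive
  refine ⟨J + 1, J.succ_pos, Fin.cons 0 w, Fin.cons 0 b,
    Fin.cons 0 fun j h => inner ℝ (Y j) (τ.basis h), fun X => ?_⟩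
  have hX : ∑ h, τ.coord X h • τ.basis h = τ.space.starProjection X :=
    Classical.choose_spec (τ.exists_coord X)
  rw [Fin.sum_univ_succ]
  simp only [Fin.cons_zero, Fin.cons_succ, zero_mul, zero_add]
  refine Finset.sum_congr rfl fun j _ => ?_
  rw [Submodule.inner_starProjection_left_eq_right, ← hX, inner_sum]
  simp only [inner_smul_right, mul_comm]


end FunNet

theorem theorem1 (σ : ℝ → ℝ) (hσ : Continuous σ)
    (hσ' : ¬ ∃ p : Polynomial ℝ, ∀ x, σ x = p.eval x)
    (d : ℕ) (K : Set FunNet.L2) (hK : IsCompact K) (F : K → ℝ) (hF : Continuous F)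
    (ε : ℝ) (hε : 0 < ε) :
    ∃ δ : ℝ, 0 < δ ∧ ∀ (L : ℕ) (τ : FunNet.Knots d L), τ.MeshLT δ →
      ∃ G ∈ FunNet.networks σ τ, ∀ X : K, |G X - F X| < ε := by
  obtain ⟨J, w, b, Y, hY⟩ := FunNet.exists_network_approx hσ hσ' hK hF (half_pos hε)
  obtain ⟨η, hη, hZ⟩ := FunNet.exists_forall_norm_sub_lt_network hσ hK w b Y (half_pos hε)
  have hev := eventually_all.2 fun j => FunNet.eventually_norm_sub_starProjection_lt d (Y j) hη
  obtain ⟨δ, hδ, hδ0⟩ := (hev.and self_mem_nhdsWithin).exists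
  refine ⟨δ, hδ0, fun L τ hτ => ⟨_, FunNet.mem_networks_starProjection τ w b Y, fun X => ?_⟩⟩
  have h1 := hZ (fun j => τ.space.starProjection (Y j)) (fun j => hδ j L τ hτ) X
  have h2 := hY X
  calc _ ≤ _ := abs_sub_le _ (∑ j, w j * σ (b j + inner ℝ (Y j) (X : FunNet.L2))) _
    _ < ε := by linarith
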